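/- Fix an integer $k\ge 1$ and work over $\mathbb{F}_2$. For positive integers $t_1,\dots,t_r$ let $m_{t_1,\dots,t_r}$ denote the monomial symmetric polynomial in $x_1,\dots,x_k$ (the sum of all distinct monomials obtained from $x_1^{t_1}\cdots x_r^{t_r}$ by permuting the variables). For $\ell\ge k$ and $0\le j\le k-1$ define, in the field $\mathbb{F}_2(x_1,\dots,x_k)$, $$p_{\ell,j}=\frac{m_{2^0,\ldots,\widehat{2^j},\ldots,2^{k-1},2^\ell}}{m_{2^0,\ldots,2^{k-1}}},$$ where the hat denotes omission. Let $V$ be the $\mathbb{F}_2$-vector space with basis $x_1,\dots,x_k$, and for $0\le j\le k-1$ let $c_j\in\mathbb{F}_2[x_1,\dots,x_k]$ be the Dickson invariant of degree $2^k-2^j$, that is, the coefficient of $T^{2^j}$ in $\prod_{v\in V}(T+v)$; put $c_j=0$ for $j<0$. **Theorem.** For $0\le j\le k-1$, (a) $p_{k+1,j}=c_{j-1}^2+c_jc_{k-1}^2$; (b) $p_{k+2,j}=c_jc_{k-2}^4+c_jc_{k-1}^6+c_{j-1}^2c_{k-1}^4+c_{j-2}^4$. In particular, these $p_{\ell,j}$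 are polynomials in $x_1,\dots,x_k$. -/

import Mathlib

/-- The monomial symmetric polynomial `m_{t_1, …, t_r}` in `x_1, …, x_k` over `𝔽₂`, where
`t_1, …, t_r` are the (positive) members of the multiset `t`. -/
noncomputable def monSymm (k : ℕ) (t : Multiset ℕ) : MvPolynomial (Fin k) (ZMod 2) :=
  MvPolynomial.msymm (Fin k) (ZMod 2) (Nat.Partition.ofMultiset t)

/-- The ratio
`p_{ℓ,j} = m_{2^0, …, omit 2^j, …, 2^{k-1}, 2^ℓ} / m_{2^0, …, 2^{k-1}}`,
as an element of the field of rational functions `𝔽₂(x_1, …, x_k)`. -/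
noncomputable def pRatio (k l j : ℕ) : FractionRing (MvPolynomial (Fin k) (ZMod 2)) :=
  algebraMap (MvPolynomial (Fin k) (ZMod 2)) (FractionRing (MvPolynomial (Fin k) (ZMod 2)))
      (monSymm k (((Finset.range k).erase j).val.map (fun i => 2 ^ i) + {2 ^ l})) /
    algebraMap (MvPolynomial (Fin k) (ZMod 2)) (FractionRing (MvPolynomial (Fin k) (ZMod 2)))
      (monSymm k ((Finset.range k).val.map (fun i => 2 ^ i)))

/-- The polynomial `∏_{v ∈ V} (T + v)` in `T`, where `V` is the `𝔽₂`-vector space with basis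
`x_1, …, x_k`, inside `𝔽₂[x_1, …, x_k] = S(V)`. -/
noncomputable def dicksonPoly (k : ℕ) : Polynomial (MvPolynomial (Fin k) (ZMod 2)) :=
  ∏ a : Fin k → ZMod 2,
    (Polynomial.X + Polynomial.C (∑ i : Fin k, MvPolynomial.C (a i) * MvPolynomial.X i))

/-- The Dickson invariant `c_i` (usually `c_{k,i}`), of degree `2^k - 2^i`: the coefficient of
`T^(2^i)` in `∏_{v ∈ V} (T + v)`, with the convention `c_i = 0` for `i < 0`. -/
noncomputable def dicksonInv (k : ℕ) (i : ℤ) : MvPolynomial (Fin k) (ZMod 2) :=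
  if 0 ≤ i then (dicksonPoly k).coeff (2 ^ i.toNat) else 0

/-! The polynomial `∏ (T + v)` is linearized and vanishes at every `x_i`, so `x_i ^ 2 ^ k = ∑ c_s
x_i ^ 2 ^ s`, with coefficients independent of `i`. Squaring and reducing the top term gives such an
expansion for each higher `x_i ^ 2 ^ l`, with the rule `d_s ↦ d_{s-1}^2 + c_s d_{k-1}^2`. In
characteristic two the monomial symmetric polynomials involved are the determinants `det (x_i ^
t_j)`, so by Cramer's rule `p_{l,j}` is the coefficient `d_j`. Applying the rule once and twice to
`d = c` gives (a) and (b). -/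

open Polynomial in
/-- In characteristic two, the product of all `X + v`, for `v` in the `𝔽₂`-span of a finite family,
is a monic linearized polynomial. -/
theorem exists_prod_X_add_C_eq_sum_pow_two_pow {R : Type*} [CommRing R] [Algebra (ZMod 2) R]
    (k : ℕ) (v : Fin k → R) :
    ∃ c : ℕ → R, c k = 1 ∧
      ∏ a : Fin k → ZMod 2, (X + C (∑ i, algebraMap (ZMod 2) R (a i) * v i)) =
        ∑ i ∈ Finset.range (k + 1), C (c i) * X ^ 2 ^ i := by
  have : CharP R[X] 2 ∨ Subsingleton R := by
    rcases subsingleton_or_nontrivial R with h | h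
    · exact Or.inr h
    · exact Or.inl (charP_of_injective_algebraMap (algebraMap (ZMod 2) R[X]).injective 2)
  rcases this with _ | _
  swap
  · exact ⟨1, rfl, Subsingleton.elim _ _⟩
  induction k with
  | zero => exact ⟨1, rfl, by simp⟩
  | succ k ih =>
    obtain ⟨c, hc, h⟩ := ih (fun i => v i.succ)
    set P := ∑ i ∈ Finset.range (k + 1), C (c i) * X ^ 2 ^ i with hP
    set b := P.eval (v 0) with hb
    -- A linearized polynomial is additive, so the coset of `v 0` contributes `P + C b`.
    have hadd : P.comp (X + C (v 0)) = P + C b := by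
      rw [hP, hb, hP, Polynomial.comp, eval₂_finsetSum, eval_finsetSum, map_sum,
        ← Finset.sum_add_distrib]
      refine Finset.sum_congr rfl fun i _ => ?_
      simp [add_pow_char_pow, mul_add]
    -- Coefficients of `P * (P + C b) = P ^ 2 + C b * P`; squaring `P` shifts indices by one.
    refine ⟨fun i => (if i = 0 then 0 else c (i - 1) ^ 2) + (if i ≤ k then b * c i else 0),
      by simp [hc], ?_⟩
    rw [← (Fin.consEquiv fun _ : Fin (k + 1) => ZMod 2).prod_comp, Fintype.prod_prod_type,
      show (Finset.univ : Finset (ZMod 2)) = {0, 1} from rfl, Finset.prod_pair zero_ne_one]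
    have h0 : ∏ y : Fin k → ZMod 2, (X + C (∑ i, algebraMap (ZMod 2) R
        ((Fin.consEquiv fun _ : Fin (k + 1) => ZMod 2) ((0 : ZMod 2), y) i) * v i)) = P := by
      rw [← h]
      simp [Fin.consEquiv, Fin.sum_univ_succ]
    have h1 : ∏ y : Fin k → ZMod 2, (X + C (∑ i, algebraMap (ZMod 2) R
        ((Fin.consEquiv fun _ : Fin (k + 1) => ZMod 2) ((1 : ZMod 2), y) i) * v i)) = P + C b := by
      rw [← hadd, ← h]
      simp [Fin.consEquiv, Fin.sum_univ_succ, Polynomial.prod_comp, add_assoc]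
    refine (congrArg₂ (· * ·) h0 h1).trans ?_
    have hsq : P ^ 2 = ∑ i ∈ Finset.range (k + 1), C (c i ^ 2) * X ^ 2 ^ (i + 1) := by
      rw [hP, sum_pow_char]
      refine Finset.sum_congr rfl fun i _ => ?_
      rw [mul_pow, ← pow_mul, C_pow, pow_succ 2 i]
    have hmul : P * (P + C b) = P ^ 2 + C b * P := by ring
    simp only
    rw [hmul, hsq]
    simp only [C_add, add_mul, Finset.sum_add_distrib]
    congr 1
    · rw [Finset.sum_range_succ' _ (k + 1)]
      simp
    · rw [Finset.sum_range_succ _ (k + 1), hP, Finset.mul_sum]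
      simp only [Nat.not_succ_le_self, if_false, C_0, zero_mul, add_zero]
      refine Finset.sum_congr rfl fun i hi => ?_
      rw [if_pos (Nat.lt_succ_iff.1 (Finset.mem_range.1 hi)), C_mul, mul_assoc]

/-! ### Dickson relations between powers of the variables -/

theorem dicksonInv_of_neg (k : ℕ) {i : ℤ} (hi : i < 0) : dicksonInv k i = 0 :=
  if_neg hi.not_ge

theorem dicksonPoly_eq_sum (k : ℕ) :
    dicksonPoly k = Polynomial.X ^ 2 ^ k +
      ∑ i ∈ Finset.range k, Polynomial.C (dicksonInv k i) * Polynomial.X ^ 2 ^ i := by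
  obtain ⟨c, hc, h⟩ := exists_prod_X_add_C_eq_sum_pow_two_pow k
    (MvPolynomial.X : Fin k → MvPolynomial (Fin k) (ZMod 2))
  have hD : dicksonPoly k =
      ∑ i ∈ Finset.range (k + 1), Polynomial.C (c i) * Polynomial.X ^ 2 ^ i := h
  have hcoeff : ∀ i ∈ Finset.range k, dicksonInv k i = c i := by
    intro i hi
    have hi' : i < k + 1 := (Finset.mem_range.1 hi).trans k.lt_succ_self
    rw [dicksonInv, if_pos (Int.natCast_nonneg i), hD, Int.toNat_natCast,
      Polynomial.finsetSum_coeff, Finset.sum_eq_single i]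
    · simp
    · intro b _ hb
      rw [Polynomial.coeff_C_mul_X_pow, if_neg]
      exact fun h => hb (Nat.pow_right_injective le_rfl h).symm
    · simp [hi']
  rw [hD, Finset.sum_range_succ, hc, add_comm]
  simp only [map_one, one_mul]
  congr 1
  exact Finset.sum_congr rfl fun i hi => by rw [hcoeff i hi]

theorem eval_X_dicksonPoly (k : ℕ) (i : Fin k) :
    (dicksonPoly k).eval (MvPolynomial.X i) = 0 := by
  rw [dicksonPoly, Polynomial.eval_prod]
  refine Finset.prod_eq_zero (Finset.mem_univ (Pi.single i 1)) ?_
  rw [Polynomial.eval_add, Polynomial.eval_X, Polynomial.eval_C, Finset.sum_eq_single i]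
  · simp [CharTwo.add_self_eq_zero]
  · intro b _ hb
    simp [Pi.single_eq_of_ne hb]
  · simp

theorem X_pow_two_pow_eq_sum_dicksonInv (k : ℕ) (i : Fin k) :
    (MvPolynomial.X i : MvPolynomial (Fin k) (ZMod 2)) ^ 2 ^ k =
      ∑ j ∈ Finset.range k, dicksonInv k j * MvPolynomial.X i ^ 2 ^ j := by
  have h := eval_X_dicksonPoly k i
  rw [dicksonPoly_eq_sum, Polynomial.eval_add, Polynomial.eval_finsetSum,
    CharTwo.add_eq_zero] at h
  simpa using h

/-- Squaring an expression of `x ^ 2 ^ l` as a linear combination of `x, x ^ 2, …, x ^ 2 ^ (k - 1)`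
and reducing the top term. -/
theorem pow_two_pow_succ_eq_sum {R : Type*} [CommRing R] [CharP R 2] {k l : ℕ} (hk : 0 < k) {x : R}
    {c d : ℤ → R} (hd : d (-1) = 0)
    (hx : x ^ 2 ^ k = ∑ i ∈ Finset.range k, c i * x ^ 2 ^ i)
    (hl : x ^ 2 ^ l = ∑ i ∈ Finset.range k, d i * x ^ 2 ^ i) :
    x ^ 2 ^ (l + 1) =
      ∑ i ∈ Finset.range k, (d (i - 1) ^ 2 + c i * d (k - 1) ^ 2) * x ^ 2 ^ i := by
  rw [pow_succ 2 l, pow_mul, hl]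
  obtain ⟨n, rfl⟩ := Nat.exists_eq_succ_of_ne_zero hk.ne'
  have hpow : ∀ i : ℕ, (d i * x ^ 2 ^ i) ^ 2 = d i ^ 2 * x ^ 2 ^ (i + 1) := fun i => by
    rw [mul_pow, ← pow_mul, pow_succ 2 i]
  rw [sum_pow_char, Finset.sum_congr rfl fun i _ => hpow i, Finset.sum_range_succ, hx]
  simp only [add_mul, Finset.sum_add_distrib]
  congr 1
  -- The shifted sum has no `i = 0` term, matching `d (-1) = 0`.
  · rw [Finset.sum_range_succ']
    simp [hd]
  · rw [Finset.mul_sum]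
    refine Finset.sum_congr rfl fun i _ => ?_
    simp only [Nat.succ_eq_add_one, Nat.cast_add, Nat.cast_one, add_sub_cancel_right]
    ring

/-! ### Monomial symmetric polynomials as determinants -/

/-- The monomial symmetric polynomial with as many distinct positive exponents as variables is the
sum over all permutations of the variables. -/
theorem monSymm_eq_sum_perm {k : ℕ} {t : Fin k → ℕ} (ht : Function.Injective t)
    (hpos : ∀ i, t i ≠ 0) :
    monSymm k (Finset.univ.val.map t) =
      ∑ σ : Equiv.Perm (Fin k), ∏ i, MvPolynomial.X (σ i) ^ t i := by
  classical
  -- `M σ` encodes the monomial `∏ X (σ i) ^ t i`. Distinct exponents make `M` injective; positive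
  -- ones make every variable occur.
  set M : Equiv.Perm (Fin k) → Multiset (Fin k) :=
    fun σ => ∑ i, Multiset.replicate (t i) (σ i) with hM
  have hcount : ∀ σ j, (M σ).count j = t (σ.symm j) := by
    intro σ j
    simp only [hM, Multiset.count_sum', Multiset.count_replicate]
    rw [Finset.sum_eq_single (σ.symm j)]
    · simp
    · intro b _ hb
      rw [if_neg]
      rintro rfl
      simp at hb
    · simp
  have hcard : ∀ σ, (M σ).card = (Finset.univ.val.map t).sum := by
    intro σ
    simp only [hM, Multiset.card_sum, Multiset.card_replicate]
    rfl
  have hfilter : (Finset.univ.val.map t).filter (· ≠ 0) = Finset.univ.val.map t := by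
    rw [Multiset.filter_eq_self]
    intro a ha
    obtain ⟨i, -, rfl⟩ := Multiset.mem_map.1 ha
    exact hpos i
  have hparts : ∀ σ, Nat.Partition.ofSym (⟨M σ, hcard σ⟩ : Sym (Fin k) _) =
      Nat.Partition.ofMultiset (Finset.univ.val.map t) := by
    intro σ
    apply Nat.Partition.ext
    rw [Nat.Partition.ofMultiset_parts, hfilter]
    have hd : (M σ).dedup = (Finset.univ : Finset (Fin k)).val := by
      refine (Multiset.Nodup.ext (Multiset.nodup_dedup _) Finset.univ.nodup).2 fun j => ?_
      simp only [Multiset.mem_dedup, Finset.mem_val, Finset.mem_univ, iff_true]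
      rw [← Multiset.count_pos, hcount]
      exact Nat.pos_of_ne_zero (hpos _)
    change (M σ).dedup.map (fun j => (M σ).count j) = _
    rw [hd]
    simp only [hcount]
    conv_rhs => rw [← Multiset.map_univ_val_equiv σ.symm, Multiset.map_map]
    rfl
  symm
  rw [monSymm, MvPolynomial.msymm]
  refine Finset.sum_bij (fun σ _ => ⟨⟨M σ, hcard σ⟩, hparts σ⟩) (fun _ _ => Finset.mem_univ _)
    ?_ ?_ ?_
  · intro σ _ τ _ h
    have h' : M σ = M τ := congrArg (fun s => s.1.1) h
    have : σ.symm = τ.symm := Equiv.ext fun j => ht (by rw [← hcount, ← hcount, h'])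
    exact Equiv.symm_bijective.injective this
  · rintro ⟨s, hs⟩ -
    have hs' : s.1.dedup.map (fun j => s.1.count j) = Finset.univ.val.map t := by
      have := congrArg Nat.Partition.parts hs
      rwa [Nat.Partition.ofMultiset_parts, hfilter] at this
    -- The variable carrying exponent `t i` is `f i`; this recovers the permutation.
    have hex : ∀ i, ∃ j, s.1.count j = t i := by
      intro i
      have hi : t i ∈ s.1.dedup.map (fun j => s.1.count j) :=
        hs'.symm ▸ Multiset.mem_map_of_mem t (Finset.mem_univ_val i)
      obtain ⟨j, -, hj⟩ := Multiset.mem_map.1 hi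
      exact ⟨j, hj⟩
    choose f hf using hex
    have hinj : Function.Injective f := fun a b h => ht (by rw [← hf a, ← hf b, h])
    refine ⟨Equiv.ofBijective f (Finite.injective_iff_bijective.1 hinj), Finset.mem_univ _, ?_⟩
    refine Subtype.ext (Subtype.ext (Multiset.ext.2 fun j => ?_))
    obtain ⟨i, rfl⟩ := (Finite.injective_iff_bijective.1 hinj).surjective j
    refine (hcount _ _).trans ?_
    rw [hf, Equiv.ofBijective_symm_apply_apply]
  · intro σ _
    change _ = ((M σ).map MvPolynomial.X).prod
    have : (M σ).map (MvPolynomial.X (R := ZMod 2)) =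
        ∑ i, Multiset.replicate (t i) (MvPolynomial.X (σ i)) := by
      rw [hM, ← Multiset.coe_mapAddMonoidHom, map_sum]
      simp
    rw [this, Multiset.prod_sum]
    simp

/-- Signs disappear in characteristic two, so permanent and determinant agree. -/
theorem monSymm_eq_det {k : ℕ} {t : Fin k → ℕ} (ht : Function.Injective t)
    (hpos : ∀ i, t i ≠ 0) :
    monSymm k (Finset.univ.val.map t) =
      (Matrix.of fun i j => (MvPolynomial.X i : MvPolynomial (Fin k) (ZMod 2)) ^ t j).det := by
  rw [monSymm_eq_sum_perm ht hpos, Matrix.det_apply']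
  refine Finset.sum_congr rfl fun σ _ => ?_
  rcases Int.units_eq_one_or (Equiv.Perm.sign σ) with h | h <;>
    simp [h, CharTwo.neg_eq]

/-- Distinct permutations give distinct monomials, so nothing cancels. -/
theorem monSymm_ne_zero {k : ℕ} {t : Fin k → ℕ} (ht : Function.Injective t)
    (hpos : ∀ i, t i ≠ 0) : monSymm k (Finset.univ.val.map t) ≠ 0 := by
  classical
  intro h
  have hmon : ∀ σ : Equiv.Perm (Fin k),
      ∏ i, (MvPolynomial.X (σ i) : MvPolynomial (Fin k) (ZMod 2)) ^ t i =
        MvPolynomial.monomial (Finsupp.equivFunOnFinite.symm fun j => t (σ.symm j)) 1 := by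
    intro σ
    rw [MvPolynomial.monomial_eq, Finsupp.prod_fintype _ _ (by simp), map_one, one_mul]
    exact Fintype.prod_equiv σ _ _ fun i => by simp
  have hc := congrArg (MvPolynomial.coeff (Finsupp.equivFunOnFinite.symm t)) h
  rw [monSymm_eq_sum_perm ht hpos, MvPolynomial.coeff_sum, Finset.sum_eq_single 1] at hc
  · rw [hmon] at hc
    have h1 : (fun j => t ((1 : Equiv.Perm (Fin k)).symm j)) = t := rfl
    simp [h1] at hc
  · intro σ _ hσ
    rw [hmon, MvPolynomial.coeff_monomial, if_neg]
    intro he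
    apply hσ
    have he' := Finsupp.equivFunOnFinite.symm.injective he
    have : σ.symm = 1 := Equiv.ext fun j => ht (congrFun he' j)
    exact Equiv.symm_bijective.injective this
  · simp

/-- Cramer's rule for the ratios `p_{ℓ,j}`. -/
theorem pRatio_eq_of_forall_pow_eq_sum {k l j : ℕ} (hj : j < k) (hl : k ≤ l)
    (d : ℤ → MvPolynomial (Fin k) (ZMod 2))
    (hd : ∀ i : Fin k, (MvPolynomial.X i : MvPolynomial (Fin k) (ZMod 2)) ^ 2 ^ l =
      ∑ s ∈ Finset.range k, d s * MvPolynomial.X i ^ 2 ^ s) :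
    pRatio k l j = algebraMap _ _ (d j) := by
  classical
  have hinj2 : Function.Injective fun n : ℕ => 2 ^ n := Nat.pow_right_injective le_rfl
  -- The numerator's exponents, with `l` placed in column `j`; `k ≤ l` keeps them distinct.
  set e : Fin k → ℕ := Function.update (fun i : Fin k => (i : ℕ)) ⟨j, hj⟩ l with he
  have heinj : Function.Injective e := by
    intro a b hab
    simp only [he, Function.update_apply] at hab
    have ha := a.2
    have hb := b.2
    split_ifs at hab with h1 h2 h2
    · rw [h1, h2]
    · omega
    · omega
    · exact Fin.ext hab
  have hden : (Finset.range k).val.map (fun i => 2 ^ i) =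
      Finset.univ.val.map fun i : Fin k => 2 ^ (i : ℕ) := by
    simp [Multiset.range, List.ofFn_eq_map, ← List.map_coe_finRange_eq_range, Function.comp_def]
  have hnum : ((Finset.range k).erase j).val.map (fun i => 2 ^ i) + {2 ^ l} =
      Finset.univ.val.map fun i : Fin k => 2 ^ e i := by
    have h1 : Finset.univ.val = (⟨j, hj⟩ : Fin k) ::ₘ (Finset.univ.erase ⟨j, hj⟩).val := by
      rw [Finset.erase_val, Multiset.cons_erase (Finset.mem_univ _)]
    have h2 : ((Finset.range k).erase j).val =
        (Finset.univ.erase (⟨j, hj⟩ : Fin k)).val.map Fin.val := by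
      rw [Finset.erase_val, Finset.erase_val, Multiset.map_erase _ Fin.val_injective]
      congr 1
      simp [Multiset.range, List.ofFn_eq_map, ← List.map_coe_finRange_eq_range]
    rw [h1, Multiset.map_cons, h2, Multiset.map_map, add_comm, Multiset.singleton_add]
    congr 1
    · simp [he]
    · refine Multiset.map_congr rfl fun i hi => ?_
      have : i ≠ ⟨j, hj⟩ := Finset.ne_of_mem_erase (Finset.mem_def.2 hi)
      simp [he, Function.update_of_ne this]
  have hvinj : Function.Injective fun i : Fin k => 2 ^ (i : ℕ) := hinj2.comp Fin.val_injective
  have hne := monSymm_ne_zero hvinj fun i => by positivity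
  rw [pRatio, hden, hnum, div_eq_iff ((map_ne_zero_iff _ (IsFractionRing.injective _ _)).2 hne),
    ← map_mul]
  congr 1
  rw [monSymm_eq_det (t := fun i => 2 ^ e i) (hinj2.comp heinj) fun i => by positivity,
    monSymm_eq_det hvinj fun i => by positivity]
  set A : Matrix (Fin k) (Fin k) (MvPolynomial (Fin k) (ZMod 2)) :=
    Matrix.of fun i j => MvPolynomial.X i ^ 2 ^ (j : ℕ) with hA
  -- Replacing column `j` by `∑ d s • column s` multiplies the determinant by `d j`.
  have hcol := Matrix.det_updateCol_sum A ⟨j, hj⟩ fun s => d s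
  rw [smul_eq_mul] at hcol
  rw [← hcol]
  congr 1
  ext1 i s
  by_cases hs : s = ⟨j, hj⟩
  · subst hs
    simp [he, hA, hd, Finset.sum_range]
  · simp [he, hA, hs]

theorem mainTheorem6 (k j : ℕ) (hj : j < k) :
    pRatio k (k + 1) j =
        algebraMap (MvPolynomial (Fin k) (ZMod 2)) (FractionRing (MvPolynomial (Fin k) (ZMod 2)))
          (dicksonInv k ((j : ℤ) - 1) ^ 2 +
            dicksonInv k (j : ℤ) * dicksonInv k ((k : ℤ) - 1) ^ 2) ∧
      pRatio k (k + 2) j =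
        algebraMap (MvPolynomial (Fin k) (ZMod 2)) (FractionRing (MvPolynomial (Fin k) (ZMod 2)))
          (dicksonInv k (j : ℤ) * dicksonInv k ((k : ℤ) - 2) ^ 4 +
            dicksonInv k (j : ℤ) * dicksonInv k ((k : ℤ) - 1) ^ 6 +
            dicksonInv k ((j : ℤ) - 1) ^ 2 * dicksonInv k ((k : ℤ) - 1) ^ 4 +
            dicksonInv k ((j : ℤ) - 2) ^ 4) := by
  have hk : 0 < k := Nat.zero_lt_of_lt hj
  have hneg := dicksonInv_of_neg k neg_one_lt_zero
  have h0 := X_pow_two_pow_eq_sum_dicksonInv k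
  have h1 (i : Fin k) := pow_two_pow_succ_eq_sum hk hneg (h0 i) (h0 i)
  -- The rule needs `d (-1) = 0` again; it holds because `c_{-1} = c_{-2} = 0`.
  have h2 (i : Fin k) := pow_two_pow_succ_eq_sum (d := fun i => dicksonInv k (i - 1) ^ 2 +
      dicksonInv k i * dicksonInv k (k - 1) ^ 2) hk
    (by simp [dicksonInv_of_neg]) (h0 i) (h1 i)
  constructor
  · exact pRatio_eq_of_forall_pow_eq_sum hj (by omega)
      (fun i => dicksonInv k (i - 1) ^ 2 + dicksonInv k i * dicksonInv k (k - 1) ^ 2) h1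
  · rw [pRatio_eq_of_forall_pow_eq_sum hj (by omega)
      (fun j => (dicksonInv k (j - 1 - 1) ^ 2 + dicksonInv k (j - 1) * dicksonInv k (k - 1) ^ 2) ^ 2
        + dicksonInv k j * (dicksonInv k (k - 1 - 1) ^ 2 +
          dicksonInv k (k - 1) * dicksonInv k (k - 1) ^ 2) ^ 2) h2]
    congr 1
    simp only [CharTwo.add_sq, sub_sub, one_add_one_eq_two]
    ring
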